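/- Let $d\ge 1$ and let $0<\gamma\le 1$. A convex body $K\subset\mathbb{R}^d$ is in $\gamma$-canonical form if $\sqrt{\gamma}\,B_0\subseteq K\subseteq B_0/\sqrt{\gamma}$, where $B_0$ is the closed unit ball centered at the origin. A cap $C$ of $K$ is a nonempty intersection of $K$ with a closed halfspace bounded by a hyperplane $h$; its base is $h\cap K$, and its width is the distance between $h$ and the hyperplane parallel to $h$ that supports $K$ at a point of the cap furthest from $h$. For $x\in K$ put $M'(x)=x+\tfrac15\big((K-x)\cap(x-K)\big)$ (the shrunken Macbeath region). Theorem. There is a constant $\Delta_0>0$, depending only on $d$ and $\gamma$, such that for all constants $a_1,a_2,b_1,b_2>0$ there is a constant $c>0$, depending only on $d,\gamma,a_1,a_2,b_1,b_2$, with the following property. Let $K\subset\mathbb{R}^d$ be a convex body in $\gamma$-canonical form, let $\varepsilon,v>0$, and let $\mathscr{C}$ be a set of caps of $K$ such that every $C\in\mathscr{C}$ satisfies $\mathrm{width}(C)\le\Delta_0$, $a_1\varepsilon\le\mathrm{width}(C)\le a_2\varepsilon$ and $b_1v\le\mathrm{vol}(C)\le b_2v$, and such that the regions $M'(x_C)$,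 where $x_C$ is the centroid of the base of $C$, are pairwise disjoint for $C\in\mathscr{C}$. Then $\mathscr{C}$ is finite and $$|\mathscr{C}|\le c\,\min\left(\frac{\varepsilon}{v},\ \frac{v}{\varepsilon^{d}}\right).$$ -/

import Mathlib

open MeasureTheory Set
open scoped RealInnerProductSpace

namespace ConvexCaps

/-- `K` is in `γ`-canonical form: `√γ B₀ ⊆ K ⊆ B₀ / √γ`, where `B₀` is the closed unit ball
centered at the origin. -/
def IsCanonical {d : ℕ} (γ : ℝ) (K : ConvexBody (EuclideanSpace ℝ (Fin d))) : Prop :=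
  Metric.closedBall 0 (√γ) ⊆ (K : Set (EuclideanSpace ℝ (Fin d))) ∧
    (K : Set (EuclideanSpace ℝ (Fin d))) ⊆ Metric.closedBall 0 (1 / √γ)

/-- A cap of `K`: a nonempty intersection of `K` with a closed halfspace
`{x | t ≤ ⟪u, x⟫}`, recorded through the unit normal `u` and the offset `t`. -/
@[ext]
structure Cap {d : ℕ} (K : ConvexBody (EuclideanSpace ℝ (Fin d))) where
  /-- the unit normal `u`, pointing into the halfspace -/
  normal : EuclideanSpace ℝ (Fin d)
  /-- the offset `t` of the bounding hyperplane `{x | ⟪u, x⟫ = t}` -/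
  offset : ℝ
  norm_normal : ‖normal‖ = 1
  nonempty : ∃ x ∈ K, offset ≤ ⟪normal, x⟫

namespace Cap

variable {d : ℕ} {K : ConvexBody (EuclideanSpace ℝ (Fin d))}

/-- The cap as a set of points. -/
def carrier (C : Cap K) : Set (EuclideanSpace ℝ (Fin d)) :=
  {x | x ∈ K ∧ C.offset ≤ ⟪C.normal, x⟫}

/-- The width of the cap: the distance between the bounding hyperplane and the parallel hyperplane
that supports `K` at the apex. -/
noncomputable def width (C : Cap K) : ℝ :=
  sSup ((fun x => ⟪C.normal, x⟫) '' (K : Set (EuclideanSpace ℝ (Fin d)))) - C.offset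

/-- The `d`-dimensional Lebesgue measure of the cap. -/
noncomputable def vol (C : Cap K) : ℝ :=
  volume.real C.carrier

/-- The base of the cap, the section of `K` by the hyperplane `{x | ⟪u, x⟫ = t}`, in the coordinate
`y ∈ uᗮ` of this hyperplane: the point `y` stands for `t • u + y`. -/
def baseCoord (C : Cap K) : Set ↥(ℝ ∙ C.normal)ᗮ :=
  {y | C.offset • C.normal + (y : EuclideanSpace ℝ (Fin d)) ∈ K}

/-- The centroid of the base, with respect to the `(d - 1)`-dimensional Lebesgue measure of the
bounding hyperplane. -/
noncomputable def baseCentroid (C : Cap K) : EuclideanSpace ℝ (Fin d) :=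
  C.offset • C.normal + ((⨍ y in C.baseCoord, y : ↥(ℝ ∙ C.normal)ᗮ) : EuclideanSpace ℝ (Fin d))

end Cap

/-- The Macbeath region `M^lam(x) = x + lam ((K - x) ∩ (x - K))`. -/
def macbeath {d : ℕ} (K : ConvexBody (EuclideanSpace ℝ (Fin d))) (lam : ℝ)
    (x : EuclideanSpace ℝ (Fin d)) : Set (EuclideanSpace ℝ (Fin d)) :=
  (fun y => x + lam • y) '' {y | x + y ∈ K ∧ x - y ∈ K}

/-- The shrunken Macbeath region `M'(x) = M^{1/5}(x)`. -/
noncomputable def shrunkenMacbeath {d : ℕ} (K : ConvexBody (EuclideanSpace ℝ (Fin d)))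
    (x : EuclideanSpace ℝ (Fin d)) : Set (EuclideanSpace ℝ (Fin d)) :=
  macbeath K (1 / 5) x

end ConvexCaps

/-!
The cardinality of a family of caps is bounded by two volume counts, one in the body `K` and one
in its polar body `K°`.

Let `C` be a cap of width `w` at most `√γ / 2`, with bounding hyperplane `{y | ⟪u, y⟫ = t}`, let
`x` be the centroid of its base and `S = (K - x) ∩ (x - K)`. Up to factors depending on `d` only,
`C` and `S` have the same volume: half of `x + S` lies in `C`, and `C` lies in a dilate of
`x + S`. The latter holds because `S` contains a fixed fraction of the base translated by `-x` (a
weak form of Minkowski's theorem on centroids, `sub_smul_sub_average_mem`) and a multiple of `x` of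
order `w / t` (`Cap.IsShallow.smul_baseCentroid_mem_kernel`). More generally, the part of `K`
within `k` widths of the base lies in a dilate of `x + S` by a factor of order `1 + k`
(`Cap.IsShallow.sub_mem_smul_kernel_of_le`).

In `K`, the disjoint regions `M'(x)` have volume at least of order `v` and lie in a shell along
the boundary of `K` of volume of order `ε`. This gives the bound `ε / v` (`card_mul_le_primal`).

In `K°`, put `f₀ = u / t`, and attach to `C` the dual region of all `f` for which `f - f₀` is
bounded by a small multiple of `ε` on `S ∪ {x}` (`Cap.dualRegion`). It lies in a shell of volume
of order `ε` along the boundary of `K°` (`Cap.IsShallow.dualRegion_subset`). Its volume is at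
least of order `εᵈ⁺¹ / v`, since the polar of `S ∪ {x}` has volume at least of order `ε / vol(S)`
by a maximal determinant argument (`exists_volume_polar_ge`). The dual regions need not be
disjoint, but they overlap boundedly: if `f` lies in the dual regions of several caps, then all
their regions `M'(x)` lie in a cap of `K` with normal `f` and width of order `ε`, which is
contained in a bounded dilate of `x + S` for any one of them (`card_le_of_mem_dualRegion`). This
gives the bound `ε / (εᵈ⁺¹ / v) = v / εᵈ` (`card_mul_le_dual`).
-/

namespace ConvexCaps

open scoped Pointwise

/-! ### The centroid of a convex body -/

/-- A weak form of Minkowski's bound on the asymmetry of a convex body about its centroid `g`: with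
a point `p`, the body contains the reflected point `g - 2⁻⁽ⁿ⁺¹⁾ (p - g)`. A functional separating
this point from the body would be positive on the body, and at least half its value at `p` on the
half-size copy of the body at `p`, which makes its mean over the body too large. -/
theorem sub_smul_sub_average_mem {F : Type*} [NormedAddCommGroup F] [NormedSpace ℝ F]
    [MeasurableSpace F] [BorelSpace F] [FiniteDimensional ℝ F] (μ : Measure F)
    [μ.IsAddHaarMeasure] {H : Set F} (hconv : Convex ℝ H) (hcomp : IsCompact H)
    (hpos : μ H ≠ 0) {n : ℕ} (hn : Module.finrank ℝ F ≤ n) {p : F} (hp : p ∈ H) :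
    (⨍ y in H, y ∂μ) - ((1 / 2 : ℝ) ^ (n + 1)) • (p - ⨍ y in H, y ∂μ) ∈ H := by
  set g := ⨍ y in H, y ∂μ with hg
  have hmeas : MeasurableSet H := hcomp.measurableSet
  have hfin : μ H ≠ ⊤ := hcomp.measure_lt_top.ne
  have hvol : 0 < μ.real H := ENNReal.toReal_pos hpos hfin
  have hint : IntegrableOn (fun y : F => y) H μ :=
    continuous_id.continuousOn.integrableOn_compact hcomp
  by_contra hnot
  obtain ⟨f, a, hlt, hall⟩ := geometric_hahn_banach_point_closed hconv hcomp.isClosed hnot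
  have hfint : IntegrableOn (fun y => f y - a) H μ :=
    (f.continuous.sub continuous_const).continuousOn.integrableOn_compact hcomp
  have hmean : ∫ y in H, (f y - a) ∂μ = μ.real H * (f g - a) := by
    rw [integral_sub (f.integrable_comp hint) (by exact integrableOn_const hfin),
      ContinuousLinearMap.integral_comp_comm f hint, setIntegral_const, hg, setAverage_eq,
      map_smul, smul_eq_mul, smul_eq_mul]
    field_simp
  -- On the half-size copy of `H` at `p`, the functional `f - a` is at least half its value at `p`.
  set H' := AffineMap.homothety p (1 / 2 : ℝ) '' H with hH'
  have hsub : H' ⊆ H := by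
    rintro _ ⟨y, hy, rfl⟩
    rw [AffineMap.homothety_eq_lineMap]
    exact hconv.lineMap_mem hp hy ⟨by norm_num, by norm_num⟩
  have hvol' : μ.real H' = (1 / 2 : ℝ) ^ Module.finrank ℝ F * μ.real H := by
    rw [Measure.real, hH', Measure.addHaar_image_homothety, ENNReal.toReal_mul,
      ENNReal.toReal_ofReal (abs_nonneg _), abs_of_nonneg (by positivity), Measure.real]
  have hmeas' : MeasurableSet H' :=
    (hcomp.image (AffineMap.homothety_continuous p _)).measurableSet
  have h1 : ∫ y in H', (f y - a) ∂μ ≤ ∫ y in H, (f y - a) ∂μ :=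
    setIntegral_mono_set hfint
      ((ae_restrict_iff' hmeas).2 (ae_of_all _ fun y hy => (sub_pos.2 (hall y hy)).le))
      (ae_of_all _ hsub)
  have h2 : μ.real H' * ((f p - a) / 2) ≤ ∫ y in H', (f y - a) ∂μ := by
    rw [← smul_eq_mul, ← setIntegral_const]
    refine setIntegral_mono_on (integrableOn_const (measure_ne_top_of_subset hsub hfin))
      (hfint.mono_set hsub) hmeas' ?_
    rintro _ ⟨y, hy, rfl⟩
    have := hall y hy
    simp only [AffineMap.homothety_apply, vsub_eq_sub, vadd_eq_add, map_add, map_smul, map_sub,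
      smul_eq_mul]
    linarith
  have hfp := hall p hp
  rw [hmean, hvol'] at *
  have h3 : (1 / 2 : ℝ) ^ Module.finrank ℝ F * ((f p - a) / 2) ≤ f g - a := by
    have := h2.trans h1
    nlinarith
  have h4 : (1 / 2 : ℝ) ^ (n + 1) * (f p - a) ≤ f g - a := by
    refine le_trans ?_ h3
    have : (1 / 2 : ℝ) ^ n ≤ (1 / 2 : ℝ) ^ Module.finrank ℝ F :=
      pow_le_pow_of_le_one (by norm_num) (by norm_num) hn
    rw [pow_succ]
    nlinarith
  have h5 : 0 < (1 / 2 : ℝ) ^ (n + 1) * (f p - a) := mul_pos (by positivity) (by linarith)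
  have h6 : 0 < (1 / 2 : ℝ) ^ (n + 1) * (f g - a) := mul_pos (by positivity) (by linarith)
  simp only [map_sub, map_smul, smul_eq_mul] at hlt
  linarith

/-! ### Packing -/

/-- Sets of measure at least `m` inside `U` that cover no point more than `N` times number at most
`N μ(U) / m`. -/
theorem card_mul_le_of_multiplicity {α ι : Type*} [MeasurableSpace α] (μ : Measure α)
    {U : Set α} (hU : MeasurableSet U) (hUfin : μ U ≠ ⊤) (F : Finset ι) {D : ι → Set α}
    (hD : ∀ i ∈ F, MeasurableSet (D i)) (hDU : ∀ i ∈ F, D i ⊆ U) {m N : ℝ}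
    (hm : ∀ i ∈ F, m ≤ μ.real (D i))
    (hN : ∀ f ∈ U, ∀ G ⊆ F, (∀ i ∈ G, f ∈ D i) → (G.card : ℝ) ≤ N) :
    F.card * m ≤ N * μ.real U := by
  classical
  have hint : ∀ i ∈ F, Integrable ((D i).indicator fun _ => (1 : ℝ)) (μ.restrict U) := fun i hi =>
    (integrable_indicator_iff (hD i hi)).2 (by
      have : IsFiniteMeasure (μ.restrict U) := ⟨by simpa using hUfin.lt_top⟩
      exact integrableOn_const (measure_ne_top _ _))
  have h1 : ∫ x in U, ∑ i ∈ F, (D i).indicator (fun _ => (1 : ℝ)) x ∂μ = ∑ i ∈ F, μ.real (D i) := by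
    rw [integral_finsetSum _ hint]
    refine Finset.sum_congr rfl fun i hi => ?_
    rw [integral_indicator_const _ (hD i hi), smul_eq_mul, mul_one,
      measureReal_restrict_apply (hD i hi), inter_eq_left.2 (hDU i hi)]
  have h2 : ∫ x in U, ∑ i ∈ F, (D i).indicator (fun _ => (1 : ℝ)) x ∂μ ≤ ∫ _ in U, N ∂μ := by
    refine setIntegral_mono_on (integrable_finsetSum _ hint) (integrableOn_const hUfin) hU ?_
    intro x hx
    refine le_trans (le_of_eq ?_) (hN x hx {i ∈ F | x ∈ D i} (Finset.filter_subset _ _) (by simp))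
    simp [indicator_apply]
  rw [h1, setIntegral_const, smul_eq_mul, mul_comm] at h2
  refine le_trans ?_ h2
  rw [← nsmul_eq_mul]
  exact Finset.card_nsmul_le_sum _ _ _ hm

theorem card_mul_le_of_pairwiseDisjoint {α ι : Type*} [MeasurableSpace α] (μ : Measure α)
    {U : Set α} (hU : MeasurableSet U) (hUfin : μ U ≠ ⊤) (F : Finset ι) {D : ι → Set α}
    (hD : ∀ i ∈ F, MeasurableSet (D i)) (hDU : ∀ i ∈ F, D i ⊆ U) {m : ℝ}
    (hm : ∀ i ∈ F, m ≤ μ.real (D i)) (hdisj : (F : Set ι).PairwiseDisjoint D) :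
    F.card * m ≤ μ.real U := by
  rw [← one_mul (μ.real U)]
  refine card_mul_le_of_multiplicity μ hU hUfin F hD hDU hm fun f _ G hG hf => ?_
  have : G.card ≤ 1 := Finset.card_le_one.2 fun i hi j hj =>
    hdisj.elim_set (hG hi) (hG hj) f (hf i hi) (hf j hj)
  exact_mod_cast this

theorem finite_and_ncard_le_of_forall_card_le {α : Type*} {s : Set α} {M : ℝ}
    (h : ∀ F : Finset α, (F : Set α) ⊆ s → (F.card : ℝ) ≤ M) : s.Finite ∧ (s.ncard : ℝ) ≤ M := by
  have hfin : s.Finite := by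
    by_contra hinf
    obtain ⟨F, hF, hcard⟩ := Set.Infinite.exists_subset_card_eq hinf (⌊M⌋₊ + 1)
    have h1 := h F hF
    rw [hcard] at h1
    push_cast at h1
    linarith [Nat.lt_floor_add_one M]
  refine ⟨hfin, ?_⟩
  rw [Set.ncard_eq_toFinset_card s hfin]
  exact h _ (by simp)

/-! ### Volumes of dilates and of shells -/

variable {d : ℕ}

theorem volume_real_smul {r : ℝ} (hr : 0 ≤ r) (s : Set (EuclideanSpace ℝ (Fin d))) :
    volume.real (r • s) = r ^ d * volume.real s := by
  rw [Measure.real, Measure.addHaar_smul, ENNReal.toReal_mul,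
    ENNReal.toReal_ofReal (abs_nonneg _), abs_of_nonneg (by positivity), Measure.real]
  simp

theorem volume_real_vadd (x : EuclideanSpace ℝ (Fin d)) (s : Set (EuclideanSpace ℝ (Fin d))) :
    volume.real ((fun y => x + y) '' s) = volume.real s := by
  rw [Measure.real, image_add_left, measure_preimage_add, Measure.real]

theorem volume_real_shell_le {P : Set (EuclideanSpace ℝ (Fin d))} (hP : Convex ℝ P)
    (hcomp : IsCompact P) (h0 : 0 ∈ P) {a b : ℝ} (ha0 : 0 ≤ a) (ha1 : a ≤ 1) (hb : 0 ≤ b) :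
    volume.real ((1 + b) • P \ (1 - a) • P) ≤ ((1 + b) ^ d - (1 - a) ^ d) * volume.real P := by
  have hsub : (1 - a) • P ⊆ (1 + b) • P := by
    rintro _ ⟨y, hy, rfl⟩
    refine ⟨((1 - a) / (1 + b)) • y, ?_, ?_⟩
    · exact hP.smul_mem_of_zero_mem h0 hy
        ⟨div_nonneg (by linarith) (by linarith), (div_le_one (by linarith)).2 (by linarith)⟩
    · have : (1 + b) ≠ 0 := by linarith
      simp only [smul_smul]
      rw [mul_div_cancel₀ _ this]
  rw [measureReal_sdiff hsub (hcomp.smul _).measurableSet (hcomp.smul _).measure_lt_top.ne,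
    volume_real_smul (by linarith), volume_real_smul (by linarith), sub_mul]

theorem one_sub_pow_ge {a : ℝ} (ha : a ≤ 1) : 1 - d * a ≤ (1 - a) ^ d := by
  have := one_add_mul_le_pow (a := -a) (by linarith) d
  rw [← sub_eq_add_neg] at this
  linarith

/-! ### The volume of the polar of a symmetric convex body -/

theorem zero_mem_interior_of_symmetric {S : Set (EuclideanSpace ℝ (Fin d))}
    (hconv : Convex ℝ S) (hsymm : ∀ y ∈ S, -y ∈ S) (hpos : volume S ≠ 0) :
    0 ∈ interior S := by
  have hne : (interior S).Nonempty := by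
    by_contra hempty
    rw [not_nonempty_iff_eq_empty] at hempty
    refine hpos (measure_mono_null ?_ (hconv.addHaar_frontier volume))
    rw [frontier, hempty, sdiff_empty]
    exact subset_closure
  obtain ⟨y, hy⟩ := hne
  have hz := hconv.combo_interior_self_mem_interior (x := y) (y := -y) (a := 1/2) (b := 1/2) hy
    (hsymm y (interior_subset hy)) (by norm_num) (by norm_num) (by norm_num)
  simpa using hz

/-- The matrix whose rows are the vectors `s i`. -/
def frameMatrix (s : Fin d → EuclideanSpace ℝ (Fin d)) : Matrix (Fin d) (Fin d) ℝ :=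
  Matrix.of fun i j => s i j

theorem det_toEuclideanLin (A : Matrix (Fin d) (Fin d) ℝ) :
    LinearMap.det (Matrix.toEuclideanLin A) = A.det := by
  rw [Matrix.toEuclideanLin, Matrix.toLpLin_eq_toLin, LinearMap.det_toLin]

theorem frameMatrix_update (s : Fin d → EuclideanSpace ℝ (Fin d)) (i : Fin d)
    (y : EuclideanSpace ℝ (Fin d)) :
    frameMatrix (Function.update s i y) = (frameMatrix s).updateRow i y := by
  ext j k
  by_cases h : j = i
  · subst h; simp [frameMatrix]
  · simp [frameMatrix, h]

theorem toEuclideanLin_frameMatrix_apply (s : Fin d → EuclideanSpace ℝ (Fin d))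
    (g : EuclideanSpace ℝ (Fin d)) (i : Fin d) :
    Matrix.toEuclideanLin (frameMatrix s) g i = ⟪g, s i⟫ := by
  simp [Matrix.toLpLin_apply, frameMatrix, Matrix.mulVec, dotProduct, PiLp.inner_apply, mul_comm]

theorem toEuclideanLin_frameMatrix_transpose_apply (s : Fin d → EuclideanSpace ℝ (Fin d))
    (a : EuclideanSpace ℝ (Fin d)) :
    Matrix.toEuclideanLin (frameMatrix s).transpose a = ∑ i, a i • s i := by
  ext j
  simp [Matrix.toLpLin_apply, frameMatrix, Matrix.mulVec, dotProduct, mul_comm]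

/-- Cramer's rule. -/
theorem det_frameMatrix_smul_eq (s : Fin d → EuclideanSpace ℝ (Fin d))
    (y : EuclideanSpace ℝ (Fin d)) :
    (frameMatrix s).det • y = ∑ i, (frameMatrix (Function.update s i y)).det • s i := by
  have h := Matrix.mulVec_cramer (frameMatrix s).transpose y
  have h2 := toEuclideanLin_frameMatrix_transpose_apply s
    (WithLp.toLp 2 ((frameMatrix s).transpose.cramer y))
  rw [Matrix.toLpLin_apply, h, Matrix.det_transpose] at h2
  simp only [Matrix.cramer_transpose_apply] at h2
  simp only [frameMatrix_update]
  exact h2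

theorem norm_apply_le (a : EuclideanSpace ℝ (Fin d)) (i : Fin d) : |a i| ≤ ‖a‖ := by
  simpa using PiLp.norm_apply_le a i

theorem sum_smul_mem {S : Set (EuclideanSpace ℝ (Fin d))}
    (hconv : Convex ℝ S) (hsymm : ∀ y ∈ S, -y ∈ S) (hd : 0 < d)
    {s : Fin d → EuclideanSpace ℝ (Fin d)} (hs : ∀ i, s i ∈ S)
    {a : Fin d → ℝ} (ha : ∀ i, |a i| ≤ 1 / d) : ∑ i, a i • s i ∈ S := by
  have hd' : (0 : ℝ) < d := by exact_mod_cast hd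
  have key : ∀ (c : ℝ), |c| ≤ 1 → ∀ y ∈ S, c • y ∈ S := by
    intro c hc y hy
    have := hconv hy (hsymm y hy) (a := (1 + c) / 2) (b := (1 - c) / 2)
      (by linarith [(abs_le.1 hc).1]) (by linarith [(abs_le.1 hc).2]) (by ring)
    convert this using 1
    module
  have h := hconv.sum_mem (t := Finset.univ) (w := fun _ : Fin d => 1 / (d : ℝ))
    (z := fun i => (d * a i) • s i) (fun _ _ => by positivity) (by simp; field_simp)
    (fun i _ => key _ (by
      rw [abs_mul, abs_of_pos hd']
      have := ha i
      rwa [le_div_iff₀ hd', mul_comm] at this) _ (hs i))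
  convert h using 2 with i
  rw [smul_smul]
  congr 1
  field_simp

theorem abs_det_mul_le_volume {S : Set (EuclideanSpace ℝ (Fin d))} (hS : IsCompact S)
    (hconv : Convex ℝ S) (hsymm : ∀ y ∈ S, -y ∈ S) (hd : 0 < d)
    {s : Fin d → EuclideanSpace ℝ (Fin d)} (hs : ∀ i, s i ∈ S) :
    |(frameMatrix s).det| * volume.real (Metric.closedBall (0 : EuclideanSpace ℝ (Fin d)) (1 / d)) ≤
      volume.real S := by
  have hsub : Matrix.toEuclideanLin (frameMatrix s).transpose ''
      Metric.closedBall (0 : EuclideanSpace ℝ (Fin d)) (1 / d) ⊆ S := by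
    rintro _ ⟨a, ha, rfl⟩
    rw [toEuclideanLin_frameMatrix_transpose_apply]
    exact sum_smul_mem hconv hsymm hd hs fun i =>
      (norm_apply_le a i).trans (by simpa using ha)
  have h := measureReal_mono (μ := volume) hsub hS.measure_lt_top.ne
  rwa [Measure.real, Measure.addHaar_image_linearMap, ENNReal.toReal_mul,
    ENNReal.toReal_ofReal (abs_nonneg _), det_toEuclideanLin, Matrix.det_transpose] at h

/-- A weak reverse Blaschke–Santaló inequality for the symmetric hull of `S` and a point `x` that
may lie far outside `S`: vectors `s₁, …, s_d` of `S ∪ {x}` of maximal determinant `Δ` express every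
point of `S ∪ {x}` with coefficients in `[-1, 1]`, so `{g | ∀ i, |⟪g, sᵢ⟫| ≤ 1 / d}`, of volume of order
`1 / |Δ|`, lies in the polar of `S ∪ {x}`; and `|Δ|` is at most of order `vol(S) / η`, because
replacing `x` by `η • x` in the frame puts the frame in `S`. -/
theorem exists_volume_polar_ge {S : Set (EuclideanSpace ℝ (Fin d))} (hS : IsCompact S)
    (hconv : Convex ℝ S) (hsymm : ∀ y ∈ S, -y ∈ S) (hpos : volume S ≠ 0) (hd : 0 < d)
    {x : EuclideanSpace ℝ (Fin d)} {η : ℝ} (hη0 : 0 < η) (hη1 : η ≤ 1) (hx : η • x ∈ S) :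
    ∃ Q : Set (EuclideanSpace ℝ (Fin d)),
      (∀ g ∈ Q, (∀ s ∈ S, |⟪g, s⟫| ≤ 1) ∧ |⟪g, x⟫| ≤ 1) ∧
      volume.real (Metric.closedBall (0 : EuclideanSpace ℝ (Fin d)) (1 / d)) ^ 2 * η ≤
        volume.real Q * volume.real S := by
  set m := volume.real (Metric.closedBall (0 : EuclideanSpace ℝ (Fin d)) (1 / d)) with hm
  have hm0 : 0 ≤ m := measureReal_nonneg
  have hcont : Continuous fun s : Fin d → EuclideanSpace ℝ (Fin d) => |(frameMatrix s).det| := by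
    refine continuous_abs.comp (Continuous.matrix_det ?_)
    refine continuous_matrix fun i j => ?_
    simp only [frameMatrix, Matrix.of_apply]
    fun_prop
  obtain ⟨s, hsT, hmax⟩ := (isCompact_univ_pi fun _ : Fin d => hS.insert x).exists_isMaxOn
    ⟨fun _ => x, fun _ _ => mem_insert _ _⟩ hcont.continuousOn
  have hsT' : ∀ i, s i = x ∨ s i ∈ S := fun i => hsT i (mem_univ i)
  have hmax' : ∀ s' : Fin d → EuclideanSpace ℝ (Fin d), (∀ i, s' i ∈ insert x S) →
      |(frameMatrix s').det| ≤ |(frameMatrix s).det| := fun s' h => hmax fun i _ => h i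
  have hdet : 0 < |(frameMatrix s).det| := by
    obtain ⟨δ, hδ, hball⟩ := Metric.mem_nhds_iff.1
      (mem_interior_iff_mem_nhds.1 (zero_mem_interior_of_symmetric hconv hsymm hpos))
    refine lt_of_lt_of_le ?_ (hmax' (fun i => (δ / 2) • EuclideanSpace.single i 1) fun i =>
      mem_insert_of_mem _ (hball ?_))
    · have : frameMatrix (fun i : Fin d => (δ / 2) • EuclideanSpace.single i (1 : ℝ)) =
          (δ / 2) • (1 : Matrix (Fin d) (Fin d) ℝ) := by
        ext i j
        simp [frameMatrix, Matrix.one_apply, eq_comm]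
      rw [this, Matrix.det_smul, Matrix.det_one]
      positivity
    · simp [norm_smul, abs_of_pos hδ]
      linarith
  have hspan : ∀ y ∈ insert x S, ∃ a : Fin d → ℝ, (∀ i, |a i| ≤ 1) ∧ y = ∑ i, a i • s i := by
    intro y hy
    refine ⟨fun i => (frameMatrix s).det⁻¹ * (frameMatrix (Function.update s i y)).det,
      fun i => ?_, ?_⟩
    · rw [abs_mul, abs_inv, inv_mul_le_iff₀ hdet, mul_one]
      refine hmax' _ fun j => ?_
      by_cases h : j = i
      · subst h; simpa using hy
      · simpa [h] using hsT j (mem_univ j)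
    · simp only [mul_smul]
      rw [← Finset.smul_sum, ← det_frameMatrix_smul_eq, smul_smul,
        inv_mul_cancel₀ (abs_pos.1 hdet), one_smul]
  have hbound : η * |(frameMatrix s).det| * m ≤ volume.real S := by
    by_cases hall : ∀ i, s i ∈ S
    · refine le_trans ?_ (abs_det_mul_le_volume hS hconv hsymm hd hall)
      refine mul_le_mul_of_nonneg_right ?_ hm0
      exact mul_le_of_le_one_left (abs_nonneg _) hη1
    · -- Exactly one vector of the frame is `x`, as two equal vectors would make `Δ` vanish.
      push Not at hall
      obtain ⟨i, hi⟩ := hall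
      have hix : s i = x := (hsT' i).resolve_right hi
      have hs' : ∀ j, Function.update s i (η • x) j ∈ S := by
        intro j
        by_cases h : j = i
        · subst h; simpa using hx
        · rw [Function.update_of_ne h]
          refine (hsT' j).resolve_left fun hjx => abs_pos.1 hdet ?_
          exact Matrix.det_zero_of_row_eq h (by ext k; simp [frameMatrix, hjx, hix])
      have h := abs_det_mul_le_volume hS hconv hsymm hd hs'
      rw [frameMatrix_update, WithLp.ofLp_smul, Matrix.det_updateRow_smul,
        ← frameMatrix_update, ← hix, Function.update_eq_self, abs_mul, abs_of_pos hη0] at h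
      exact h
  refine ⟨Matrix.toEuclideanLin (frameMatrix s) ⁻¹'
    Metric.closedBall (0 : EuclideanSpace ℝ (Fin d)) (1 / d), fun g hg => ?_, ?_⟩
  · have hgi : ∀ i, |⟪g, s i⟫| ≤ 1 / d := fun i => by
      rw [← toEuclideanLin_frameMatrix_apply]
      exact (norm_apply_le _ i).trans (by simpa using hg)
    have hy : ∀ y ∈ insert x S, |⟪g, y⟫| ≤ 1 := by
      intro y hy
      obtain ⟨a, ha, rfl⟩ := hspan y hy
      rw [inner_sum]
      refine (Finset.abs_sum_le_sum_abs _ _).trans ?_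
      have hd' : (d : ℝ) ≠ 0 := by exact_mod_cast hd.ne'
      calc ∑ i, |⟪g, a i • s i⟫| ≤ ∑ _i : Fin d, (1 / d : ℝ) := Finset.sum_le_sum fun i _ => by
            rw [inner_smul_right, abs_mul]
            exact (mul_le_of_le_one_left (abs_nonneg _) (ha i)).trans (hgi i)
        _ = 1 := by simp [hd']
    exact ⟨fun y h => hy y (mem_insert_of_mem _ h), hy x (mem_insert _ _)⟩
  · have hne : LinearMap.det (Matrix.toEuclideanLin (frameMatrix s)) ≠ 0 := by
      rw [det_toEuclideanLin]; exact abs_pos.1 hdet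
    rw [Measure.real, Measure.addHaar_preimage_linearMap _ hne, ENNReal.toReal_mul,
      ENNReal.toReal_ofReal (abs_nonneg _), det_toEuclideanLin, abs_inv, ← Measure.real, ← hm]
    have h1 : m ^ 2 * η = |(frameMatrix s).det|⁻¹ * m * (η * |(frameMatrix s).det| * m) := by
      field_simp
    rw [h1]
    exact mul_le_mul_of_nonneg_left hbound (by positivity)

/-! ### Macbeath regions -/

variable {γ : ℝ} {K : ConvexBody (EuclideanSpace ℝ (Fin d))}

/-- The centrally symmetric convex set `(K - x) ∩ (x - K)`, of which the Macbeath regions of `K` at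
`x` are scaled translates. -/
def macbeathKernel (K : ConvexBody (EuclideanSpace ℝ (Fin d))) (x : EuclideanSpace ℝ (Fin d)) :
    Set (EuclideanSpace ℝ (Fin d)) :=
  {y | x + y ∈ K ∧ x - y ∈ K}

section Kernel
variable {x y : EuclideanSpace ℝ (Fin d)}

theorem neg_mem_macbeathKernel (hy : y ∈ macbeathKernel K x) : -y ∈ macbeathKernel K x := by
  refine ⟨?_, ?_⟩
  · rw [← sub_eq_add_neg]; exact hy.2
  · rw [sub_neg_eq_add]; exact hy.1

theorem convex_macbeathKernel : Convex ℝ (macbeathKernel K x) := by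
  intro a ha b hb p q hp hq hpq
  obtain rfl : p = 1 - q := by linarith
  refine ⟨?_, ?_⟩
  · change _ ∈ (K : Set (EuclideanSpace ℝ (Fin d)))
    convert K.convex ha.1 hb.1 hp hq hpq using 1
    module
  · change _ ∈ (K : Set (EuclideanSpace ℝ (Fin d)))
    convert K.convex ha.2 hb.2 hp hq hpq using 1
    module

theorem isCompact_macbeathKernel : IsCompact (macbeathKernel K x) := by
  have hc : IsClosed (macbeathKernel K x) :=
    (K.isCompact.isClosed.preimage (by fun_prop : Continuous fun y => x + y)).inter
      (K.isCompact.isClosed.preimage (by fun_prop : Continuous fun y => x - y))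
  refine (K.isCompact.image (by fun_prop : Continuous fun y => y - x)).of_isClosed_subset hc ?_
  intro y hy
  exact ⟨x + y, hy.1, by simp⟩

theorem zero_mem_macbeathKernel (hx : x ∈ K) :
    (0 : EuclideanSpace ℝ (Fin d)) ∈ macbeathKernel K x :=
  ⟨by simpa using hx, by simpa using hx⟩

theorem macbeath_eq_image (lam : ℝ) :
    macbeath K lam x = (fun y => x + y) '' (lam • macbeathKernel K x) := by
  ext p
  constructor
  · rintro ⟨y, hy, rfl⟩
    exact ⟨lam • y, smul_mem_smul_set hy, rfl⟩
  · rintro ⟨_, ⟨y, hy, rfl⟩, rfl⟩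
    exact ⟨y, hy, rfl⟩

theorem volume_real_macbeath {lam : ℝ} (hlam : 0 ≤ lam) :
    volume.real (macbeath K lam x) = lam ^ d * volume.real (macbeathKernel K x) := by
  rw [macbeath_eq_image, volume_real_vadd, volume_real_smul hlam]

theorem isCompact_macbeath {lam : ℝ} : IsCompact (macbeath K lam x) := by
  rw [macbeath_eq_image]
  exact (isCompact_macbeathKernel.smul lam).image (by fun_prop)

theorem smul_mem_smul_macbeathKernel (hx : x ∈ K) {a b : ℝ} (ha : 0 ≤ a) (hab : a ≤ b)
    (hy : y ∈ a • macbeathKernel K x) : y ∈ b • macbeathKernel K x := by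
  obtain ⟨y, hy, rfl⟩ := hy
  rcases ha.eq_or_lt with rfl | ha'
  · exact ⟨0, zero_mem_macbeathKernel hx, by simp⟩
  · have hb : 0 < b := ha'.trans_le hab
    refine ⟨(a / b) • y, convex_macbeathKernel.smul_mem_of_zero_mem (zero_mem_macbeathKernel hx) hy
      ⟨by positivity, (div_le_one hb).2 hab⟩, ?_⟩
    simp only [smul_smul]
    rw [mul_div_cancel₀ _ hb.ne']

theorem add_mem_smul_macbeathKernel {a b : ℝ} (ha : 0 ≤ a) (hb : 0 ≤ b)
    {z : EuclideanSpace ℝ (Fin d)}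
    (hy : y ∈ a • macbeathKernel K x) (hz : z ∈ b • macbeathKernel K x) :
    y + z ∈ (a + b) • macbeathKernel K x := by
  rw [convex_macbeathKernel.add_smul ha hb]
  exact add_mem_add hy hz

theorem neg_mem_smul_macbeathKernel {a : ℝ}
    (hy : y ∈ a • macbeathKernel K x) : -y ∈ a • macbeathKernel K x := by
  obtain ⟨y, hy, rfl⟩ := hy
  exact ⟨-y, neg_mem_macbeathKernel hy, by simp⟩

theorem macbeath_subset (hx : x ∈ K) {lam : ℝ} (h0 : 0 ≤ lam)
    (h1 : lam ≤ 1) : macbeath K lam x ⊆ K := by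
  rintro _ ⟨s, hs, rfl⟩
  exact (convex_macbeathKernel.smul_mem_of_zero_mem (zero_mem_macbeathKernel hx) hs ⟨h0, h1⟩).1

end Kernel

/-! ### The geometry of shallow caps -/

namespace Cap

/-- The cap `C` has positive width at most `√γ / 2`, and the body is in `γ`-canonical form. The
bounding hyperplane then has distance at least `√γ / 2` from the origin, and the width of the cap is
at most this distance. -/
structure IsShallow (γ : ℝ) (C : Cap K) : Prop where
  γ_pos : 0 < γ
  canonical : IsCanonical γ K
  width_pos : 0 < C.width
  width_le : C.width ≤ √γ / 2

variable {C : Cap K}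

theorem inner_le (C : Cap K) {y : EuclideanSpace ℝ (Fin d)} (hy : y ∈ K) :
    ⟪C.normal, y⟫ ≤ C.offset + C.width := by
  have hb : BddAbove ((fun x => ⟪C.normal, x⟫) '' (K : Set (EuclideanSpace ℝ (Fin d)))) :=
    (K.isCompact.image (by fun_prop)).bddAbove
  have := le_csSup hb ⟨y, hy, rfl⟩
  unfold width
  linarith

theorem exists_apex (C : Cap K) : ∃ z ∈ K, ⟪C.normal, z⟫ = C.offset + C.width := by
  have hc : IsCompact ((fun x => ⟪C.normal, x⟫) '' (K : Set (EuclideanSpace ℝ (Fin d)))) :=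
    K.isCompact.image (by fun_prop)
  obtain ⟨z, hz, h⟩ := hc.sSup_mem (K.nonempty.image _)
  exact ⟨z, hz, by unfold width; rw [← h]; ring⟩

theorem mem_orthogonal_normal {y : EuclideanSpace ℝ (Fin d)} (hy : ⟪C.normal, y⟫ = 0) :
    y ∈ (ℝ ∙ C.normal)ᗮ := Submodule.mem_orthogonal_singleton_iff_inner_right.2 hy

theorem inner_coe_orthogonal (y : ↥(ℝ ∙ C.normal)ᗮ) :
    ⟪C.normal, (y : EuclideanSpace ℝ (Fin d))⟫ = 0 :=
  Submodule.mem_orthogonal_singleton_iff_inner_right.1 y.2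

theorem convex_baseCoord : Convex ℝ C.baseCoord := by
  intro a ha b hb p q hp hq hpq
  have := K.convex ha hb hp hq hpq
  change C.offset • C.normal + ((p • a + q • b : ↥(ℝ ∙ C.normal)ᗮ) : EuclideanSpace ℝ (Fin d)) ∈
    (K : Set (EuclideanSpace ℝ (Fin d)))
  convert this using 1
  obtain rfl : p = 1 - q := by linarith
  push_cast
  module

theorem isCompact_baseCoord : IsCompact C.baseCoord := by
  have hc : Topology.IsClosedEmbedding
      fun y : ↥(ℝ ∙ C.normal)ᗮ => C.offset • C.normal + (y : EuclideanSpace ℝ (Fin d)) :=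
    (Homeomorph.addLeft (C.offset • C.normal)).isClosedEmbedding.comp
      (Submodule.isClosed_orthogonal _).isClosedEmbedding_subtypeVal
  exact hc.isCompact_preimage K.isCompact

theorem inner_baseCentroid (C : Cap K) : ⟪C.normal, C.baseCentroid⟫ = C.offset := by
  unfold baseCentroid
  rw [inner_add_right, inner_coe_orthogonal, inner_smul_right, real_inner_self_eq_norm_sq,
    C.norm_normal]
  ring

theorem isCompact_carrier : IsCompact C.carrier :=
  K.isCompact.inter_right (isClosed_le (f := fun _ => C.offset) (g := fun x => ⟪C.normal, x⟫)
    continuous_const (by fun_prop))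

/-- The half of the translated kernel beyond the bounding hyperplane lies in the cap. -/
theorem volume_kernel_le :
    volume.real (macbeathKernel K C.baseCentroid) ≤ 2 * C.vol := by
  set S := macbeathKernel K C.baseCentroid with hS
  set P := {y ∈ S | 0 ≤ ⟪C.normal, y⟫} with hP
  have hPS : S ⊆ P ∪ (-1 : ℝ) • P := by
    intro y hy
    rcases le_total 0 ⟪C.normal, y⟫ with hle | hle
    · exact Or.inl ⟨hy, hle⟩
    · refine Or.inr ⟨-y, ⟨neg_mem_macbeathKernel hy, by rw [inner_neg_right]; linarith⟩, by simp⟩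
  have hPC : (fun y => C.baseCentroid + y) '' P ⊆ C.carrier := by
    rintro _ ⟨y, hy, rfl⟩
    refine ⟨hy.1.1, ?_⟩
    rw [inner_add_right, inner_baseCentroid]
    linarith [hy.2]
  have hPfin : volume P ≠ ⊤ :=
    measure_ne_top_of_subset (fun _ hy => hy.1) isCompact_macbeathKernel.measure_lt_top.ne
  have hneg : volume.real ((-1 : ℝ) • P) = volume.real P := by
    rw [Measure.real, Measure.addHaar_smul, ENNReal.toReal_mul, Measure.real]
    simp
  have hnegfin : volume ((-1 : ℝ) • P) ≠ ⊤ := by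
    rw [Measure.addHaar_smul]
    exact ENNReal.mul_ne_top ENNReal.ofReal_ne_top hPfin
  have h1 : volume.real P ≤ C.vol := by
    rw [← volume_real_vadd C.baseCentroid]
    exact measureReal_mono hPC isCompact_carrier.measure_lt_top.ne
  calc volume.real S ≤ volume.real (P ∪ (-1 : ℝ) • P) :=
        measureReal_mono hPS (measure_union_ne_top hPfin hnegfin)
    _ ≤ volume.real P + volume.real ((-1 : ℝ) • P) := measureReal_union_le _ _
    _ ≤ 2 * C.vol := by rw [hneg]; linarith

namespace IsShallow

variable (h : C.IsShallow γ)
include h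

theorem sqrt_pos : 0 < √γ := Real.sqrt_pos.2 h.γ_pos

theorem zero_mem : (0 : EuclideanSpace ℝ (Fin d)) ∈ K :=
  h.canonical.1 (by simp)

theorem mem_of_norm_le {y : EuclideanSpace ℝ (Fin d)} (hy : ‖y‖ ≤ √γ) : y ∈ K :=
  h.canonical.1 (by simpa using hy)

theorem norm_le {y : EuclideanSpace ℝ (Fin d)} (hy : y ∈ K) : ‖y‖ ≤ 1 / √γ := by
  simpa using h.canonical.2 hy

theorem sqrt_le : √γ ≤ C.offset + C.width := by
  have := C.inner_le (y := √γ • C.normal)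
    (h.mem_of_norm_le (by
      rw [norm_smul, C.norm_normal, Real.norm_of_nonneg h.sqrt_pos.le, mul_one]))
  rw [inner_smul_right, real_inner_self_eq_norm_sq, C.norm_normal] at this
  linarith

theorem half_sqrt_le : √γ / 2 ≤ C.offset := by
  linarith [h.sqrt_le, h.width_le]

theorem offset_pos : 0 < C.offset := by linarith [h.half_sqrt_le, h.sqrt_pos]

theorem width_le_offset : C.width ≤ C.offset := h.width_le.trans h.half_sqrt_le

theorem add_le : C.offset + C.width ≤ 1 / √γ := by
  obtain ⟨z, hz, hz'⟩ := C.exists_apex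
  rw [← hz']
  refine (real_inner_le_norm _ _).trans ?_
  rw [C.norm_normal, one_mul]
  exact h.norm_le hz

theorem offset_le : C.offset ≤ 1 / √γ := by linarith [h.add_le, h.width_pos]

theorem volume_baseCoord_ne_zero : volume C.baseCoord ≠ 0 := by
  obtain ⟨z, hz, hz'⟩ := C.exists_apex
  have hpos : 0 < C.offset + C.width := by linarith [h.offset_pos, h.width_pos]
  set θ := C.offset / (C.offset + C.width) with hθ
  have hθ0 : 0 < θ := div_pos h.offset_pos hpos
  have hθ1 : θ < 1 := (div_lt_one hpos).2 (by linarith [h.width_pos])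
  have hy0 : θ • z - C.offset • C.normal ∈ (ℝ ∙ C.normal)ᗮ := by
    apply mem_orthogonal_normal
    rw [inner_sub_right, inner_smul_right, inner_smul_right, real_inner_self_eq_norm_sq,
      C.norm_normal, hz', hθ]
    field_simp
    ring
  have hsub : Metric.ball (⟨_, hy0⟩ : ↥(ℝ ∙ C.normal)ᗮ) ((1 - θ) * √γ) ⊆ C.baseCoord := by
    intro y hy
    rw [mem_ball_iff_norm, Submodule.coe_norm] at hy
    set b := (y : EuclideanSpace ℝ (Fin d)) - (θ • z - C.offset • C.normal) with hb
    have hbK : (1 - θ)⁻¹ • b ∈ K := h.mem_of_norm_le (by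
      rw [norm_smul, Real.norm_of_nonneg (inv_nonneg.2 (by linarith)),
        inv_mul_le_iff₀ (by linarith)]
      exact hy.le)
    have := K.convex hz hbK hθ0.le (by linarith : 0 ≤ 1 - θ) (by ring)
    change C.offset • C.normal + (y : EuclideanSpace ℝ (Fin d)) ∈
      (K : Set (EuclideanSpace ℝ (Fin d)))
    convert this using 1
    rw [smul_smul, mul_inv_cancel₀ (by linarith), hb]
    module
  exact fun h0 => (Metric.measure_ball_pos volume _ (mul_pos (by linarith) h.sqrt_pos)).ne'
    (measure_mono_null hsub h0)

theorem baseCentroid_mem : C.baseCentroid ∈ K := by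
  exact convex_baseCoord.set_average_mem isCompact_baseCoord.isClosed h.volume_baseCoord_ne_zero
      isCompact_baseCoord.measure_lt_top.ne
      ((ae_restrict_iff' isCompact_baseCoord.measurableSet).2 (ae_of_all _ fun _ hy => hy))
      (continuous_id.continuousOn.integrableOn_compact isCompact_baseCoord)

theorem sub_smul_mem {p : EuclideanSpace ℝ (Fin d)} (hp : p ∈ K)
    (hp' : ⟪C.normal, p⟫ = C.offset) :
    C.baseCentroid - ((1 / 2 : ℝ) ^ (d + 1)) • (p - C.baseCentroid) ∈ K := by
  have hy0 : p - C.offset • C.normal ∈ (ℝ ∙ C.normal)ᗮ := by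
    apply mem_orthogonal_normal
    rw [inner_sub_right, inner_smul_right, real_inner_self_eq_norm_sq, C.norm_normal, hp']
    ring
  have hyb : (⟨_, hy0⟩ : ↥(ℝ ∙ C.normal)ᗮ) ∈ C.baseCoord := by
    show C.offset • C.normal + (p - C.offset • C.normal) ∈ K
    simpa using hp
  have := sub_smul_sub_average_mem volume convex_baseCoord isCompact_baseCoord
    h.volume_baseCoord_ne_zero (n := d) (by simpa using Submodule.finrank_le (ℝ ∙ C.normal)ᗮ) hyb
  change C.offset • C.normal + ((_ : ↥(ℝ ∙ C.normal)ᗮ) : EuclideanSpace ℝ (Fin d)) ∈ K at this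
  convert this using 1
  unfold baseCentroid
  push_cast
  module

theorem smul_sub_mem_kernel {p : EuclideanSpace ℝ (Fin d)} (hp : p ∈ K)
    (hp' : ⟪C.normal, p⟫ = C.offset) :
    ((1 / 2 : ℝ) ^ (d + 1)) • (p - C.baseCentroid) ∈ macbeathKernel K C.baseCentroid := by
  refine ⟨?_, h.sub_smul_mem hp hp'⟩
  have hρ : (1 / 2 : ℝ) ^ (d + 1) ≤ 1 := pow_le_one₀ (by norm_num) (by norm_num)
  have := K.convex h.baseCentroid_mem hp (sub_nonneg.2 hρ)
    (by positivity : (0 : ℝ) ≤ (1 / 2 : ℝ) ^ (d + 1)) (by ring)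
  change _ ∈ (K : Set (EuclideanSpace ℝ (Fin d)))
  convert this using 1
  module

theorem sub_mem_smul_kernel {p : EuclideanSpace ℝ (Fin d)} (hp : p ∈ K)
    (hp' : ⟪C.normal, p⟫ = C.offset) :
    p - C.baseCentroid ∈ ((2 : ℝ) ^ (d + 1)) • macbeathKernel K C.baseCentroid := by
  refine ⟨_, h.smul_sub_mem_kernel hp hp', ?_⟩
  simp [smul_smul]

/-- The kernel at the base centroid `x` reaches a distance comparable to the width in the direction
of `x`. Outwards this holds because, by the asymmetry bound for the base, a multiple `(1 + η) x`
lies on a segment from a point of the base to the apex, wherever the apex is. -/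
theorem smul_baseCentroid_mem_kernel :
    ((1 / 2 : ℝ) ^ (d + 3) * (C.width / C.offset)) • C.baseCentroid ∈
      macbeathKernel K C.baseCentroid := by
  set x := C.baseCentroid
  have ht := h.offset_pos
  have hw := h.width_pos
  have hr1 : C.width / C.offset ≤ 1 := (div_le_one ht).2 h.width_le_offset
  have hr0 : 0 < C.width / C.offset := div_pos hw ht
  set r := C.width / C.offset with hr
  set ρ := (1 / 2 : ℝ) ^ (d + 1) with hρ
  have hρ0 : 0 < ρ := by positivity
  have hρ1 : ρ ≤ 1 := pow_le_one₀ (by norm_num) (by norm_num)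
  have hη : (1 / 2 : ℝ) ^ (d + 3) = ρ / 4 := by rw [hρ, pow_add, pow_add]; ring
  rw [hη]
  refine ⟨?_, ?_⟩
  · obtain ⟨z, hz, hz'⟩ := C.exists_apex
    -- `q` is the radial projection of the apex to the base.
    set q := (C.offset / (C.offset + C.width)) • z with hq
    have hzq : z = (1 + r) • q := by
      rw [hq, smul_smul, hr]
      rw [show (1 + C.width / C.offset) * (C.offset / (C.offset + C.width)) = 1 by
        field_simp, one_smul]
    have hqK : q ∈ K := K.convex.smul_mem_of_zero_mem h.zero_mem hz
      ⟨by positivity, (div_le_one (by positivity)).2 (by linarith)⟩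
    have hq' : ⟪C.normal, q⟫ = C.offset := by
      rw [hq, inner_smul_right, hz']; field_simp
    -- `β` is chosen so that `(1 + ρ r / 4) x` lies on the segment from the point `x - β (q - x)` of
    -- the base to the apex `z`.
    set β := ρ / 4 * (1 + r) / (1 - ρ / 4) with hβ
    have hβ0 : 0 ≤ β := div_nonneg (by positivity) (by linarith)
    have hβ1 : β ≤ ρ := by
      rw [hβ, div_le_iff₀ (by linarith)]
      nlinarith
    have hx'' : x - β • (q - x) ∈ K := by
      have := K.convex h.baseCentroid_mem (h.sub_smul_mem hqK hq') (a := 1 - β / ρ) (b := β / ρ)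
        (sub_nonneg.2 ((div_le_one hρ0).2 hβ1)) (by positivity) (by ring)
      change _ ∈ (K : Set (EuclideanSpace ℝ (Fin d)))
      convert this using 1
      rw [smul_sub (β / ρ), ← hρ, smul_smul (β / ρ), div_mul_cancel₀ _ hρ0.ne']
      module
    have := K.convex hx'' hz (a := 1 - ρ / 4) (b := ρ / 4) (by linarith) (by linarith) (by ring)
    change _ ∈ (K : Set (EuclideanSpace ℝ (Fin d)))
    convert this using 1
    rw [hzq, smul_sub (1 - ρ / 4), smul_smul (1 - ρ / 4), hβ,
      mul_div_cancel₀ _ (by linarith : (1 - ρ / 4) ≠ 0)]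
    module
  · have : (1 - ρ / 4 * r) • x ∈ (K : Set (EuclideanSpace ℝ (Fin d))) :=
      K.convex.smul_mem_of_zero_mem h.zero_mem h.baseCentroid_mem ⟨by nlinarith, by nlinarith⟩
    change _ ∈ (K : Set (EuclideanSpace ℝ (Fin d)))
    convert this using 1
    module

theorem smul_baseCentroid_mem_smul_kernel {c : ℝ} (hc0 : 0 ≤ c) (hc : c ≤ C.width / C.offset) :
    c • C.baseCentroid ∈ ((2 : ℝ) ^ (d + 3)) • macbeathKernel K C.baseCentroid := by
  have hr0 : 0 < C.width / C.offset := div_pos h.width_pos h.offset_pos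
  refine ⟨(c / (C.width / C.offset)) • ((1 / 2 : ℝ) ^ (d + 3) * (C.width / C.offset)) •
    C.baseCentroid, convex_macbeathKernel.smul_mem_of_zero_mem
      (zero_mem_macbeathKernel h.baseCentroid_mem) h.smul_baseCentroid_mem_kernel
      ⟨by positivity, (div_le_one hr0).2 hc⟩, ?_⟩
  simp only [smul_smul]
  congr 1
  have : (2 : ℝ) ^ (d + 3) * (1 / 2) ^ (d + 3) = 1 := by rw [← mul_pow]; norm_num
  calc _ = (2 : ℝ) ^ (d + 3) * (1 / 2) ^ (d + 3) *
        (c / (C.width / C.offset) * (C.width / C.offset)) := by ring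
    _ = c := by rw [this, div_mul_cancel₀ _ hr0.ne', one_mul]

/-- A shallow cap lies in a dilate, by a factor depending only on `d`, of the Macbeath region of its
base centroid. -/
theorem sub_mem_smul_kernel_of_mem_carrier {y : EuclideanSpace ℝ (Fin d)} (hy : y ∈ C.carrier) :
    y - C.baseCentroid ∈ ((2 : ℝ) ^ (d + 4)) • macbeathKernel K C.baseCentroid := by
  obtain ⟨hyK, hty⟩ := hy
  have ht := h.offset_pos
  have hxK := h.baseCentroid_mem
  -- `l⁻¹ • y` is the radial projection of `y` to the base.
  set l := ⟪C.normal, y⟫ / C.offset with hl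
  have hl1 : 1 ≤ l := (one_le_div ht).2 hty
  have hl0 : 0 < l := by linarith
  have hlw : l - 1 ≤ C.width / C.offset := by
    rw [hl, div_sub_one ht.ne']
    gcongr
    linarith [C.inner_le hyK]
  have hl2 : l ≤ 2 := by linarith [(div_le_one ht).2 h.width_le_offset]
  have hy' : l⁻¹ • y ∈ K := K.convex.smul_mem_of_zero_mem h.zero_mem hyK
    ⟨by positivity, inv_le_one_of_one_le₀ hl1⟩
  have h1 := h.sub_mem_smul_kernel hy' (by
    have : 0 < ⟪C.normal, y⟫ := by linarith
    rw [inner_smul_right, hl]; field_simp)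
  have h2 : l • (l⁻¹ • y - C.baseCentroid) ∈
      ((2 : ℝ) ^ (d + 2)) • macbeathKernel K C.baseCentroid := by
    obtain ⟨s, hs, hs'⟩ := h1
    refine smul_mem_smul_macbeathKernel hxK (a := l * 2 ^ (d + 1)) (by positivity) ?_
      ⟨s, hs, ?_⟩
    · rw [pow_succ _ (d + 1)]
      nlinarith [pow_pos (two_pos : (0 : ℝ) < 2) (d + 1)]
    · simp only at hs' ⊢
      rw [← hs', smul_smul]
  have h3 := add_mem_smul_macbeathKernel (by positivity) (by positivity) h2
    (h.smul_baseCentroid_mem_smul_kernel (sub_nonneg.2 hl1) hlw)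
  refine smul_mem_smul_macbeathKernel hxK (by positivity) ?_ (a := 2 ^ (d + 2) + 2 ^ (d + 3)) ?_
  · rw [pow_add, pow_add, pow_add]; nlinarith [pow_pos (two_pos : (0 : ℝ) < 2) d]
  · convert h3 using 1
    rw [smul_sub, smul_smul, mul_inv_cancel₀ hl0.ne', one_smul]
    module

/-- The part of the body within `k` widths of the base lies in a dilate of the Macbeath region of
the base centroid, by a factor linear in `k`. -/
theorem sub_mem_smul_kernel_of_le {y : EuclideanSpace ℝ (Fin d)} (hy : y ∈ K) {k : ℝ} (hk : 0 ≤ k)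
    (hky : C.offset - k * C.width ≤ ⟪C.normal, y⟫) :
    y - C.baseCentroid ∈ ((2 : ℝ) ^ (d + 5) * (1 + k)) • macbeathKernel K C.baseCentroid := by
  have hxK := h.baseCentroid_mem
  have hw := h.width_pos
  have hp : (0 : ℝ) < 2 ^ d := by positivity
  have hpk : (0 : ℝ) ≤ 2 ^ d * k := by positivity
  by_cases hty : C.offset ≤ ⟪C.normal, y⟫
  · refine smul_mem_smul_macbeathKernel hxK (by positivity) ?_
      (h.sub_mem_smul_kernel_of_mem_carrier ⟨hy, hty⟩)
    rw [pow_add, pow_add]; nlinarith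
  · push Not at hty
    obtain ⟨z, hz, hz'⟩ := C.exists_apex
    have hzC : z ∈ C.carrier := ⟨hz, by linarith⟩
    -- The segment from the apex `z` to `y` meets the base at `p`.
    set b := (C.offset - ⟪C.normal, y⟫) / C.width with hb
    have hb0 : 0 ≤ b := div_nonneg (by linarith) hw.le
    have hbk : b ≤ k := (div_le_iff₀ hw).2 (by linarith)
    have hby : ⟪C.normal, y⟫ = C.offset - b * C.width := by rw [hb]; field_simp; ring
    have hb1 : (1 + b) ≠ 0 := by linarith
    set p := (b / (1 + b)) • z + (1 / (1 + b)) • y with hpdef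
    have hpK : p ∈ K := K.convex hz hy (by positivity) (by positivity) (by field_simp; ring)
    have hp' : ⟪C.normal, p⟫ = C.offset := by
      rw [hpdef, inner_add_right, inner_smul_right, inner_smul_right, hz', hby]
      field_simp
      ring
    have hyp : y - C.baseCentroid =
        (1 + b) • (p - C.baseCentroid) + b • -(z - C.baseCentroid) := by
      rw [hpdef, smul_sub, smul_add, smul_smul, smul_smul, mul_div_cancel₀ _ hb1,
        mul_one_div_cancel hb1]
      module
    rw [hyp]
    have h1 : (1 + b) • (p - C.baseCentroid) ∈
        ((1 + b) * 2 ^ (d + 1)) • macbeathKernel K C.baseCentroid := by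
      rw [mul_smul]; exact smul_mem_smul_set (h.sub_mem_smul_kernel hpK hp')
    have h2 : b • -(z - C.baseCentroid) ∈
        (b * 2 ^ (d + 4)) • macbeathKernel K C.baseCentroid := by
      rw [mul_smul]
      exact smul_mem_smul_set
        (neg_mem_smul_macbeathKernel (h.sub_mem_smul_kernel_of_mem_carrier hzC))
    refine smul_mem_smul_macbeathKernel hxK (by positivity) ?_
      (add_mem_smul_macbeathKernel (by positivity) (by positivity) h1 h2)
    rw [pow_add, pow_add, pow_add]
    nlinarith [mul_le_mul_of_nonneg_left hbk hp.le]

theorem vol_le :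
    C.vol ≤ ((2 : ℝ) ^ (d + 4)) ^ d * volume.real (macbeathKernel K C.baseCentroid) := by
  rw [← volume_real_smul (by positivity), ← volume_real_vadd C.baseCentroid]
  refine measureReal_mono ?_
    ((isCompact_macbeathKernel.smul _).image
      (continuous_const_add C.baseCentroid)).measure_lt_top.ne
  exact fun y hy => ⟨_, h.sub_mem_smul_kernel_of_mem_carrier hy, by simp⟩

/-! ### The packing bound in the body -/

theorem le_volume_shrunkenMacbeath {A : ℝ} (hA : A ≤ C.vol) :
    A / (5 * 2 ^ (d + 4)) ^ d ≤ volume.real (shrunkenMacbeath K C.baseCentroid) := by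
  rw [shrunkenMacbeath, volume_real_macbeath (by norm_num), div_le_iff₀ (by positivity), mul_pow]
  refine (hA.trans h.vol_le).trans (le_of_eq ?_)
  have : (1 / 5 : ℝ) ^ d * 5 ^ d = 1 := by rw [← mul_pow]; norm_num
  linear_combination
    (-((2 : ℝ) ^ (d + 4)) ^ d * volume.real (macbeathKernel K C.baseCentroid)) * this

/-- The shrunken Macbeath region of the base centroid lies in the shell of `K` of relative thickness
of order `W`. The minimum keeps the inner body `(1 - a) • K` a genuine dilate when `W` is large. -/
theorem shrunkenMacbeath_subset {W : ℝ} (hW : C.width ≤ W) :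
    shrunkenMacbeath K C.baseCentroid ⊆
      (1 + 0 : ℝ) • (K : Set (EuclideanSpace ℝ (Fin d))) \
        (1 - min 1 (2 * W / √γ)) • (K : Set (EuclideanSpace ℝ (Fin d))) := by
  intro p hp
  have hpK := macbeath_subset h.baseCentroid_mem (by norm_num) (by norm_num) hp
  refine ⟨by simpa using hpK, ?_⟩
  rintro ⟨k, hk, hkp⟩
  obtain ⟨s, hs, rfl⟩ := hp
  simp only at hkp
  have hw := h.width_pos
  have hsγ := h.sqrt_pos
  have h1 := C.inner_le hs.2
  have h2 := C.inner_le hk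
  have h3 := congrArg (fun q => ⟪C.normal, q⟫) hkp
  simp only [inner_add_right, inner_smul_right, inner_sub_right, inner_baseCentroid] at h1 h3
  have h4 : 6 / 5 * C.width < min 1 (2 * W / √γ) * (C.offset + C.width) := by
    rcases min_choice 1 (2 * W / √γ) with hm | hm
    · rw [hm]; linarith [h.width_le_offset]
    · rw [hm, div_mul_eq_mul_div (2 * W), lt_div_iff₀ hsγ]
      have h5 : 0 < C.width * √γ := mul_pos hw hsγ
      have h6 := mul_le_mul_of_nonneg_right hW
        (h.offset_pos.le.trans (le_add_of_nonneg_right hw.le))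
      have h7 := mul_le_mul_of_nonneg_left h.sqrt_le hw.le
      nlinarith
  have h8 : 0 ≤ 1 - min 1 (2 * W / √γ) := sub_nonneg.2 (min_le_left _ _)
  nlinarith [mul_le_mul_of_nonneg_left h2 h8]

end IsShallow
end Cap

theorem volume_real_le_of_canonical (hK : IsCanonical γ K) :
    volume.real (K : Set (EuclideanSpace ℝ (Fin d))) ≤
      volume.real (Metric.closedBall (0 : EuclideanSpace ℝ (Fin d)) (1 / √γ)) :=
  measureReal_mono hK.2 (isCompact_closedBall _ _).measure_lt_top.ne

/-- The packing bound in `K`: the disjoint shrunken Macbeath regions have volume of order at least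
`A`, and lie in a shell of volume of order `W`. -/
theorem card_mul_le_primal (hγ : 0 < γ) (hK : IsCanonical γ K) {W A : ℝ} (hW0 : 0 ≤ W)
    (F : Finset (Cap K)) (hF : ∀ C ∈ F, C.IsShallow γ) (hW : ∀ C ∈ F, C.width ≤ W)
    (hA : ∀ C ∈ F, A ≤ C.vol)
    (hdisj : (F : Set (Cap K)).PairwiseDisjoint fun C => shrunkenMacbeath K C.baseCentroid) :
    F.card * (A / (5 * 2 ^ (d + 4)) ^ d) ≤
      d * (2 * W / √γ) *
        volume.real (Metric.closedBall (0 : EuclideanSpace ℝ (Fin d)) (1 / √γ)) := by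
  have h0K : (0 : EuclideanSpace ℝ (Fin d)) ∈ (K : Set (EuclideanSpace ℝ (Fin d))) :=
    hK.1 (by simp)
  have hmin0 : 0 ≤ min 1 (2 * W / √γ) := le_min zero_le_one (by positivity)
  have h1 := card_mul_le_of_pairwiseDisjoint volume
    (U := (1 + 0 : ℝ) • (K : Set (EuclideanSpace ℝ (Fin d))) \
        (1 - min 1 (2 * W / √γ)) • (K : Set (EuclideanSpace ℝ (Fin d))))
    ((K.isCompact.smul _).measurableSet.diff (K.isCompact.smul _).measurableSet)
    (measure_ne_top_of_subset sdiff_subset (K.isCompact.smul _).measure_lt_top.ne) F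
    (fun C _ => isCompact_macbeath.measurableSet)
    (fun C hC => (hF C hC).shrunkenMacbeath_subset (hW C hC))
    (fun C hC => (hF C hC).le_volume_shrunkenMacbeath (hA C hC)) hdisj
  have h2 := volume_real_shell_le K.convex K.isCompact h0K hmin0 (min_le_left _ _) le_rfl
  refine h1.trans (h2.trans ?_)
  refine mul_le_mul ?_ (volume_real_le_of_canonical hK) measureReal_nonneg (by positivity)
  have h3 := one_sub_pow_ge (d := d) (min_le_left 1 (2 * W / √γ))
  have h4 : (d : ℝ) * min 1 (2 * W / √γ) ≤ d * (2 * W / √γ) :=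
    mul_le_mul_of_nonneg_left (min_le_right _ _) (by positivity)
  simp only [add_zero, one_pow]
  linarith

/-! ### The polar body and the dual regions -/

/-- The polar body `K° = {f | ∀ y ∈ K, ⟪f, y⟫ ≤ 1}`. -/
def polarBody (K : ConvexBody (EuclideanSpace ℝ (Fin d))) : Set (EuclideanSpace ℝ (Fin d)) :=
  {f | ∀ y ∈ K, ⟪f, y⟫ ≤ 1}

theorem convex_polarBody : Convex ℝ (polarBody K) := by
  intro f hf g hg a b ha hb hab y hy
  rw [inner_add_left, real_inner_smul_left, real_inner_smul_left]
  nlinarith [mul_le_mul_of_nonneg_left (hf y hy) ha, mul_le_mul_of_nonneg_left (hg y hy) hb]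

theorem zero_mem_polarBody : (0 : EuclideanSpace ℝ (Fin d)) ∈ polarBody K := fun y _ => by
  simp

theorem polarBody_subset_closedBall (hγ : 0 < γ) (hK : IsCanonical γ K) :
    polarBody K ⊆ Metric.closedBall 0 (1 / √γ) := by
  intro f hf
  have hs : 0 < √γ := Real.sqrt_pos.2 hγ
  rw [mem_closedBall_zero_iff, le_div_iff₀ hs]
  rcases (norm_nonneg f).eq_or_lt with h0 | h0
  · rw [← h0]; simp
  · have hmem : (√γ / ‖f‖) • f ∈ K := hK.1 (by
      rw [mem_closedBall_zero_iff, norm_smul, Real.norm_of_nonneg (by positivity),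
        div_mul_cancel₀ _ h0.ne'])
    have := hf _ hmem
    rw [inner_smul_right, real_inner_self_eq_norm_sq] at this
    calc ‖f‖ * √γ = √γ / ‖f‖ * ‖f‖ ^ 2 := by field_simp
      _ ≤ 1 := this

theorem isCompact_polarBody (hγ : 0 < γ) (hK : IsCanonical γ K) : IsCompact (polarBody K) := by
  refine (isCompact_closedBall _ _).of_isClosed_subset ?_ (polarBody_subset_closedBall hγ hK)
  have : polarBody K = ⋂ y ∈ K, {f | ⟪f, y⟫ ≤ 1} := by ext; simp [polarBody]
  rw [this]
  exact isClosed_biInter fun y _ => isClosed_le (by fun_prop) continuous_const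

namespace Cap
variable {C : Cap K}

/-- The dual region of a cap, on the polar side: the points `f` whose difference from the pole
`u / t` of the bounding hyperplane `{y | ⟪u, y⟫ = t}` is bounded by `δ` on the kernel at the base
centroid `x`, and at `x` itself. -/
def dualRegion (C : Cap K) (δ : ℝ) : Set (EuclideanSpace ℝ (Fin d)) :=
  {f | (∀ s ∈ macbeathKernel K C.baseCentroid, |⟪f - C.offset⁻¹ • C.normal, s⟫| ≤ δ) ∧
    |⟪f - C.offset⁻¹ • C.normal, C.baseCentroid⟫| ≤ δ}

theorem isClosed_dualRegion (C : Cap K) (δ : ℝ) : IsClosed (C.dualRegion δ) := by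
  have : C.dualRegion δ = (⋂ s ∈ macbeathKernel K C.baseCentroid,
      {f | |⟪f - C.offset⁻¹ • C.normal, s⟫| ≤ δ}) ∩
      {f | |⟪f - C.offset⁻¹ • C.normal, C.baseCentroid⟫| ≤ δ} := by
    ext; simp [dualRegion]
  rw [this]
  exact (isClosed_biInter fun y _ => isClosed_le (by fun_prop) continuous_const).inter
    (isClosed_le (by fun_prop) continuous_const)

namespace IsShallow
variable (h : C.IsShallow γ)
include h

theorem sqrt_le_one : √γ ≤ 1 := by
  have h1 := h.sqrt_le.trans h.add_le
  rw [le_div_iff₀ h.sqrt_pos] at h1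
  nlinarith [h.sqrt_pos]

theorem one_sub_le_inner_of_mem_dualRegion {δ : ℝ} {f : EuclideanSpace ℝ (Fin d)}
    (hf : f ∈ C.dualRegion δ) : 1 - δ ≤ ⟪f, C.baseCentroid⟫ := by
  have h1 := (abs_le.1 hf.2).1
  rw [inner_sub_left, real_inner_smul_left, inner_baseCentroid, inv_mul_cancel₀ h.offset_pos.ne']
    at h1
  linarith

theorem inner_le_of_mem_dualRegion {δ : ℝ} {f : EuclideanSpace ℝ (Fin d)}
    (hf : f ∈ C.dualRegion δ) {y : EuclideanSpace ℝ (Fin d)} (hy : y ∈ K) {k : ℝ} (hk : 0 ≤ k)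
    (hky : C.offset - k * C.width ≤ ⟪C.normal, y⟫) :
    ⟪f, y⟫ ≤ C.offset⁻¹ * ⟪C.normal, y⟫ + δ + 2 ^ (d + 5) * (1 + k) * δ := by
  obtain ⟨s, hs, hs'⟩ := h.sub_mem_smul_kernel_of_le hy hk hky
  simp only at hs'
  have h1 := (abs_le.1 (hf.1 s hs)).2
  have h2 := (abs_le.1 hf.2).2
  have h3 : ⟪f, y⟫ = C.offset⁻¹ * ⟪C.normal, y⟫ + ⟪f - C.offset⁻¹ • C.normal, C.baseCentroid⟫ +
      2 ^ (d + 5) * (1 + k) * ⟪f - C.offset⁻¹ • C.normal, s⟫ := by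
    rw [← real_inner_smul_left, ← real_inner_smul_right, hs', add_assoc, ← inner_add_right,
      add_sub_cancel, inner_sub_left]
    ring
  rw [h3]
  have : 2 ^ (d + 5) * (1 + k) * ⟪f - C.offset⁻¹ • C.normal, s⟫ ≤ 2 ^ (d + 5) * (1 + k) * δ :=
    mul_le_mul_of_nonneg_left h1 (by positivity)
  linarith

variable {r : ℝ} {f y : EuclideanSpace ℝ (Fin d)}

theorem inner_le_of_offset_le (hr0 : 0 < r) (hf : f ∈ C.dualRegion (√γ / 2 ^ (d + 6) * r))
    (hy : y ∈ K) (hty : C.offset ≤ ⟪C.normal, y⟫) : ⟪f, y⟫ ≤ 1 + C.width / C.offset + r := by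
  have h1 := h.inner_le_of_mem_dualRegion hf hy le_rfl (by linarith)
  have h2 : C.offset⁻¹ * ⟪C.normal, y⟫ ≤ 1 + C.width / C.offset := by
    rw [inv_mul_le_iff₀ h.offset_pos, mul_add, mul_one, mul_div_cancel₀ _ h.offset_pos.ne']
    exact C.inner_le hy
  have hp : (1 : ℝ) ≤ 2 ^ (d + 5) := one_le_pow₀ (by norm_num)
  have h3 : √γ / 2 ^ (d + 6) * r + 2 ^ (d + 5) * (1 + 0) * (√γ / 2 ^ (d + 6) * r) ≤ r := by
    have : √γ / 2 ^ (d + 6) * r + 2 ^ (d + 5) * (1 + 0) * (√γ / 2 ^ (d + 6) * r) =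
      (1 / 2 ^ (d + 6) + 1 / 2) * √γ * r := by rw [pow_succ _ (d + 5)]; field_simp; ring
    rw [this]
    have h4 : (1 : ℝ) / 2 ^ (d + 6) ≤ 1 / 2 := by
      rw [pow_succ _ (d + 5)]
      exact one_div_le_one_div_of_le (by norm_num) (by linarith)
    have h5 : (1 / 2 ^ (d + 6) + 1 / 2) * √γ ≤ 1 * 1 :=
      mul_le_mul (by linarith) h.sqrt_le_one h.sqrt_pos.le zero_le_one
    nlinarith
  linarith

/-- The choice `δ = √γ r / 2⁽ᵈ⁺⁶⁾` lets a point `f` of the dual region fall off, below the bounding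
hyperplane, at no less than half the rate of the pole of that hyperplane. -/
theorem inner_le_of_le_offset (hr0 : 0 < r) (hr : r ≤ C.width)
    (hf : f ∈ C.dualRegion (√γ / 2 ^ (d + 6) * r)) (hy : y ∈ K) (hty : ⟪C.normal, y⟫ ≤ C.offset) :
    ⟪f, y⟫ ≤ 1 - (C.offset - ⟪C.normal, y⟫) / (2 * C.offset) + r := by
  have ht := h.offset_pos
  have hw := h.width_pos
  set e := C.offset - ⟪C.normal, y⟫ with he
  have he0 : 0 ≤ e := by linarith
  have h1 := h.inner_le_of_mem_dualRegion hf hy (k := e / C.width) (by positivity)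
    (by rw [div_mul_cancel₀ _ hw.ne', he]; linarith)
  have h2 : C.offset⁻¹ * ⟪C.normal, y⟫ = 1 - e / C.offset := by
    rw [he]; field_simp; ring
  have hsγ := h.sqrt_pos
  have hp : (1 : ℝ) ≤ 2 ^ (d + 5) := one_le_pow₀ (by norm_num)
  have h3 : √γ / 2 ^ (d + 6) * r + 2 ^ (d + 5) * (1 + e / C.width) * (√γ / 2 ^ (d + 6) * r) =
      (1 / 2 ^ (d + 6) + 1 / 2) * √γ * r + e * (√γ * (r / C.width)) / 2 := by
    rw [pow_succ _ (d + 5)]; field_simp; ring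
  have h4 : (1 : ℝ) / 2 ^ (d + 6) ≤ 1 / 2 := by
    rw [pow_succ _ (d + 5)]
    exact one_div_le_one_div_of_le (by norm_num) (by linarith)
  have h5 : (1 / 2 ^ (d + 6) + 1 / 2) * √γ ≤ 1 * 1 :=
    mul_le_mul (by linarith) h.sqrt_le_one h.sqrt_pos.le zero_le_one
  have h6 : √γ * (r / C.width) ≤ 1 / C.offset := by
    have h7 : √γ ≤ 1 / C.offset := by
      have := h.offset_le
      rw [le_div_iff₀ hsγ] at this
      rw [le_div_iff₀ ht]; linarith
    calc √γ * (r / C.width) ≤ √γ * 1 :=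
          mul_le_mul_of_nonneg_left ((div_le_one hw).2 hr) hsγ.le
      _ ≤ 1 / C.offset := by linarith
  have h8 := mul_le_mul_of_nonneg_left h6 he0
  have h9 : e / (2 * C.offset) = e / C.offset - e * (1 / C.offset) / 2 := by field_simp; ring
  rw [h9]
  nlinarith

theorem inner_le_of_mem {κ : ℝ} (hr0 : 0 < r) (hr : r ≤ C.width) (hκ : C.width ≤ κ * r)
    (hf : f ∈ C.dualRegion (√γ / 2 ^ (d + 6) * r)) (hy : y ∈ K) :
    ⟪f, y⟫ ≤ 1 + (1 + 2 * κ / √γ) * r := by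
  have hsγ := h.sqrt_pos
  have ht := h.offset_pos
  rcases le_total C.offset ⟪C.normal, y⟫ with hty | hty
  · have h1 := h.inner_le_of_offset_le hr0 hf hy hty
    have h2 : C.width / C.offset ≤ κ * r / (√γ / 2) :=
      div_le_div₀ (h.width_pos.le.trans hκ) hκ (by positivity) h.half_sqrt_le
    have h3 : κ * r / (√γ / 2) = 2 * κ / √γ * r := by field_simp
    linarith
  · have h1 := h.inner_le_of_le_offset hr0 hr hf hy hty
    have h2 : 0 ≤ (C.offset - ⟪C.normal, y⟫) / (2 * C.offset) :=
      div_nonneg (by linarith) (by linarith)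
    have h3 : 0 ≤ 2 * κ / √γ * r := by
      have : 0 ≤ κ * r := h.width_pos.le.trans hκ
      have h4 : 2 * κ / √γ * r = 2 * (κ * r) / √γ := by ring
      rw [h4]; positivity
    linarith

theorem dual_const_lt (hr0 : 0 < r) : √γ / 2 ^ (d + 6) * r < r := by
  have hp : (1 : ℝ) < 2 ^ (d + 6) := one_lt_pow₀ (by norm_num) (by omega)
  have : √γ / 2 ^ (d + 6) < 1 := (div_lt_one (by positivity)).2 (by linarith [h.sqrt_le_one])
  nlinarith

/-- The dual region lies near the boundary of the polar body, within distance of order `r`. -/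
theorem dualRegion_subset {κ : ℝ} (hr0 : 0 < r) (hr1 : r ≤ 1) (hr : r ≤ C.width)
    (hκ : C.width ≤ κ * r) :
    C.dualRegion (√γ / 2 ^ (d + 6) * r) ⊆
      (1 + (1 + 2 * κ / √γ) * r) • polarBody K \ (1 - r) • polarBody K := by
  intro f hf
  have hκ0 : 0 < κ := by
    by_contra hneg
    push Not at hneg
    nlinarith [h.width_pos]
  have hpos : 0 < 1 + (1 + 2 * κ / √γ) * r := by
    have := h.sqrt_pos
    positivity
  refine ⟨?_, ?_⟩
  · refine ⟨(1 + (1 + 2 * κ / √γ) * r)⁻¹ • f, fun y hy => ?_, ?_⟩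
    · rw [real_inner_smul_left, inv_mul_le_iff₀ hpos, mul_one]
      exact h.inner_le_of_mem hr0 hr hκ hf hy
    · simp only [smul_smul]
      rw [mul_inv_cancel₀ hpos.ne', one_smul]
  · rintro ⟨g, hg, hgf⟩
    have h1 := h.one_sub_le_inner_of_mem_dualRegion hf
    have h2 := hg _ h.baseCentroid_mem
    have h3 := h.dual_const_lt hr0
    rw [← hgf, real_inner_smul_left] at h1
    nlinarith

/-- The dual region has volume at least of order `δᵈ r / A'`: the polar of the kernel has volume of
order `1 / vol(C)`, and the constraint at the base centroid costs a further factor `r`. -/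
theorem volume_dualRegion_ge {δ A' : ℝ} (hd : 0 < d) (hδ : 0 ≤ δ) (hvol : 0 < C.vol)
    (hA' : C.vol ≤ A') (hr : 0 < r) (hrw : r ≤ C.width) (hfin : volume (C.dualRegion δ) ≠ ⊤) :
    δ ^ d * (volume.real (Metric.closedBall (0 : EuclideanSpace ℝ (Fin d)) (1 / d)) ^ 2 *
      ((1 / 2) ^ (d + 3) * (r * √γ))) / (2 * A') ≤ volume.real (C.dualRegion δ) := by
  set S := macbeathKernel K C.baseCentroid with hS
  set m := volume.real (Metric.closedBall (0 : EuclideanSpace ℝ (Fin d)) (1 / d)) with hm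
  have ht := h.offset_pos
  have hw := h.width_pos
  have hSpos : 0 < volume.real S := by
    have := hvol.trans_le h.vol_le
    exact pos_of_mul_pos_right this (by positivity)
  have hS0 : volume S ≠ 0 := fun h0 => hSpos.ne' (by rw [Measure.real, h0]; rfl)
  have hη1 : (1 / 2 : ℝ) ^ (d + 3) * (C.width / C.offset) ≤ 1 :=
    mul_le_one₀ (pow_le_one₀ (by norm_num) (by norm_num)) (by positivity)
      ((div_le_one ht).2 h.width_le_offset)
  obtain ⟨Q, hQ, hvolQ⟩ := exists_volume_polar_ge isCompact_macbeathKernel convex_macbeathKernel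
    (fun _ => neg_mem_macbeathKernel) hS0 hd (by positivity) hη1 h.smul_baseCentroid_mem_kernel
  have hsub : (fun y => C.offset⁻¹ • C.normal + y) '' (δ • Q) ⊆ C.dualRegion δ := by
    rintro _ ⟨_, ⟨g, hg, rfl⟩, rfl⟩
    have key : ∀ z : EuclideanSpace ℝ (Fin d), |⟪g, z⟫| ≤ 1 →
        |⟪C.offset⁻¹ • C.normal + δ • g - C.offset⁻¹ • C.normal, z⟫| ≤ δ := fun z hz => by
      rw [add_sub_cancel_left, real_inner_smul_left, abs_mul, abs_of_nonneg hδ]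
      exact mul_le_of_le_one_right hδ hz
    exact ⟨fun s hs => key s ((hQ g hg).1 s hs), key _ (hQ g hg).2⟩
  have h1 := measureReal_mono (μ := volume) hsub hfin
  rw [volume_real_vadd, volume_real_smul hδ] at h1
  refine le_trans ?_ h1
  have h2 : r * √γ ≤ C.width / C.offset := by
    rw [le_div_iff₀ ht]
    have h3 : √γ * C.offset ≤ 1 := by
      have := h.offset_le
      rw [le_div_iff₀ h.sqrt_pos] at this
      linarith
    nlinarith
  have h4 : volume.real S ≤ 2 * A' := volume_kernel_le.trans (by linarith)
  have hA0 : 0 < 2 * A' := by linarith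
  rw [mul_div_assoc]
  refine mul_le_mul_of_nonneg_left ?_ (by positivity)
  rw [div_le_iff₀ hA0]
  calc m ^ 2 * ((1 / 2) ^ (d + 3) * (r * √γ))
      ≤ m ^ 2 * ((1 / 2) ^ (d + 3) * (C.width / C.offset)) := by gcongr
    _ ≤ volume.real Q * volume.real S := hvolQ
    _ ≤ volume.real Q * (2 * A') := mul_le_mul_of_nonneg_left h4 measureReal_nonneg

end IsShallow
end Cap

/-! ### The packing bound in the polar body -/

/-- A point `f` lies in boundedly many dual regions: the shrunken Macbeath regions belonging to them
lie in a common cap of `K` with normal `f`, hence in one bounded dilate of the Macbeath region of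
any one of these caps, which has room for boundedly many of them. -/
theorem card_le_of_mem_dualRegion {r κ A A' : ℝ} (hr0 : 0 < r) (hκ0 : 0 < κ) (hA0 : 0 < A)
    (hAA' : A ≤ A')
    (G : Finset (Cap K)) (hG : ∀ C ∈ G, C.IsShallow γ) (hr : ∀ C ∈ G, r ≤ C.width)
    (hκ : ∀ C ∈ G, C.width ≤ κ * r) (hA : ∀ C ∈ G, A ≤ C.vol) (hA' : ∀ C ∈ G, C.vol ≤ A')
    (hdisj : (G : Set (Cap K)).PairwiseDisjoint fun C => shrunkenMacbeath K C.baseCentroid)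
    {f : EuclideanSpace ℝ (Fin d)}
    (hf : ∀ C ∈ G, f ∈ C.dualRegion (√γ / 2 ^ (d + 6) * r)) :
    (G.card : ℝ) ≤ (2 ^ (d + 5) * (1 + 2 * (4 + 2 * κ / √γ) / √γ)) ^ d * (2 * A') *
      (5 * 2 ^ (d + 4)) ^ d / A := by
  rcases G.eq_empty_or_nonempty with rfl | ⟨C₀, hC₀⟩
  · have : 0 < A' := hA0.trans_le hAA'
    simp only [Finset.card_empty, Nat.cast_zero]
    positivity
  have h₀ := hG C₀ hC₀
  have hsγ := h₀.sqrt_pos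
  set k := 2 * (4 + 2 * κ / √γ) / √γ with hk
  have hk0 : 0 ≤ k := by positivity
  set B := (2 : ℝ) ^ (d + 5) * (1 + k) with hB
  have hB0 : 0 ≤ B := by positivity
  set U := (fun y => C₀.baseCentroid + y) '' (B • macbeathKernel K C₀.baseCentroid) with hU
  have hUc : IsCompact U :=
    (isCompact_macbeathKernel.smul B).image (continuous_const_add C₀.baseCentroid)
  have hsub : ∀ C ∈ G, shrunkenMacbeath K C.baseCentroid ⊆ U := by
    intro C hC p hp
    have h := hG C hC
    have hpK : p ∈ K := macbeath_subset h.baseCentroid_mem (by norm_num) (by norm_num) hp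
    -- `f` is at most `1 + O(r)` on `K`, in particular at the point `x - s` opposite to `x + s`, and it is
    -- at least `1 - r` at the centroid `x`, which bounds it below at `p = x + s / 5`.
    have hfp : 1 - (3 + 2 * κ / √γ) * r ≤ ⟪f, p⟫ := by
      obtain ⟨s, hs, rfl⟩ := hp
      have h1 := h.inner_le_of_mem hr0 (hr C hC) (hκ C hC) (hf C hC) hs.2
      have h2 := h.one_sub_le_inner_of_mem_dualRegion (hf C hC)
      have h3 := h.dual_const_lt hr0
      rw [inner_sub_right] at h1
      simp only [inner_add_right, inner_smul_right]
      have h4 : 0 ≤ 2 * κ / √γ * r := by positivity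
      nlinarith
    -- By the decay of `f` below the base of `C₀`, the point `p` is within `k` widths of this base.
    refine ⟨p - C₀.baseCentroid, h₀.sub_mem_smul_kernel_of_le hpK hk0 ?_, by simp⟩
    rcases le_total C₀.offset ⟪C₀.normal, p⟫ with hty | hty
    · nlinarith [mul_nonneg hk0 h₀.width_pos.le]
    · have h1 := h₀.inner_le_of_le_offset hr0 (hr C₀ hC₀) (hf C₀ hC₀) hpK hty
      have ht := h₀.offset_pos
      have h2 : (C₀.offset - ⟪C₀.normal, p⟫) / (2 * C₀.offset) ≤ (4 + 2 * κ / √γ) * r := by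
        linarith
      rw [div_le_iff₀ (by positivity)] at h2
      have h3 : (4 + 2 * κ / √γ) * r * (2 * C₀.offset) ≤ k * C₀.width := by
        calc (4 + 2 * κ / √γ) * r * (2 * C₀.offset)
            ≤ (4 + 2 * κ / √γ) * C₀.width * (2 * (1 / √γ)) := by
              gcongr
              · have := h₀.width_pos
                positivity
              · exact hr C₀ hC₀
              · exact h₀.offset_le
          _ = k * C₀.width := by rw [hk]; field_simp
      linarith
  have h1 := card_mul_le_of_pairwiseDisjoint volume hUc.measurableSet hUc.measure_lt_top.ne G
    (fun C _ => isCompact_macbeath.measurableSet) hsub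
    (fun C hC => (hG C hC).le_volume_shrunkenMacbeath (hA C hC)) hdisj
  rw [hU, volume_real_vadd, volume_real_smul hB0] at h1
  have h2 : volume.real (macbeathKernel K C₀.baseCentroid) ≤ 2 * A' :=
    Cap.volume_kernel_le.trans (by linarith [hA' C₀ hC₀])
  have h3 := h1.trans (mul_le_mul_of_nonneg_left h2 (by positivity))
  rw [le_div_iff₀ hA0]
  rw [mul_div_assoc', div_le_iff₀ (by positivity)] at h3
  exact h3

/-- The packing bound in the polar body: the dual regions have volume of order at least
`rᵈ⁺¹ / A'`, lie in a shell of volume of order `r`, and overlap with bounded multiplicity. -/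
theorem card_mul_le_dual (hd : 0 < d) (hγ : 0 < γ) (hK : IsCanonical γ K) {r κ A A' : ℝ}
    (hr0 : 0 < r) (hr1 : r ≤ 1) (hκ0 : 0 < κ) (hA0 : 0 < A) (hAA' : A ≤ A')
    (F : Finset (Cap K)) (hF : ∀ C ∈ F, C.IsShallow γ) (hr : ∀ C ∈ F, r ≤ C.width)
    (hκ : ∀ C ∈ F, C.width ≤ κ * r) (hA : ∀ C ∈ F, A ≤ C.vol) (hA' : ∀ C ∈ F, C.vol ≤ A')
    (hdisj : (F : Set (Cap K)).PairwiseDisjoint fun C => shrunkenMacbeath K C.baseCentroid) :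
    F.card * ((√γ / 2 ^ (d + 6) * r) ^ d *
      (volume.real (Metric.closedBall (0 : EuclideanSpace ℝ (Fin d)) (1 / d)) ^ 2 *
      ((1 / 2) ^ (d + 3) * (r * √γ))) / (2 * A')) ≤
      ((2 ^ (d + 5) * (1 + 2 * (4 + 2 * κ / √γ) / √γ)) ^ d * (2 * A') *
      (5 * 2 ^ (d + 4)) ^ d / A) * ((((2 + 2 * κ / √γ) ^ d + d) * r) *
        volume.real (Metric.closedBall (0 : EuclideanSpace ℝ (Fin d)) (1 / √γ))) := by
  have hP := isCompact_polarBody hγ hK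
  have hsγ : 0 < √γ := Real.sqrt_pos.2 hγ
  have hA'0 : 0 < A' := hA0.trans_le hAA'
  set b := (1 + 2 * κ / √γ) * r with hb
  have hb0 : 0 ≤ b := by positivity
  have hUfin : volume ((1 + b) • polarBody K \ (1 - r) • polarBody K) ≠ ⊤ :=
    measure_ne_top_of_subset sdiff_subset (hP.smul _).measure_lt_top.ne
  have hsub : ∀ C ∈ F, C.dualRegion (√γ / 2 ^ (d + 6) * r) ⊆
      (1 + b) • polarBody K \ (1 - r) • polarBody K := fun C hC =>
    (hF C hC).dualRegion_subset hr0 hr1 (hr C hC) (hκ C hC)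
  have h1 := card_mul_le_of_multiplicity volume
    ((hP.smul (1 + b)).measurableSet.diff (hP.smul (1 - r)).measurableSet) hUfin F
    (fun C _ => (C.isClosed_dualRegion _).measurableSet) hsub
    (fun C hC => (hF C hC).volume_dualRegion_ge hd (by positivity) (hA0.trans_le (hA C hC))
      (hA' C hC) hr0 (hr C hC) (measure_ne_top_of_subset (hsub C hC) hUfin))
    (fun f _ G hGF hG => card_le_of_mem_dualRegion hr0 hκ0 hA0 hAA' G (fun C hC => hF C (hGF hC))
      (fun C hC => hr C (hGF hC)) (fun C hC => hκ C (hGF hC)) (fun C hC => hA C (hGF hC))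
      (fun C hC => hA' C (hGF hC)) (hdisj.subset (by exact_mod_cast hGF)) hG)
  refine h1.trans (mul_le_mul_of_nonneg_left ?_ (by positivity))
  refine (volume_real_shell_le convex_polarBody hP zero_mem_polarBody hr0.le hr1 hb0).trans ?_
  refine mul_le_mul ?_ (measureReal_mono (polarBody_subset_closedBall hγ hK)
    (isCompact_closedBall _ _).measure_lt_top.ne) measureReal_nonneg (by positivity)
  have h2 := one_sub_pow_ge (d := d) hr1
  -- Convexity of the power function bounds `(1 + b) ^ d` linearly in `r` for `r ≤ 1`.
  have h3 := (convexOn_pow (𝕜 := ℝ) d).2 (x := 1) (y := 2 + 2 * κ / √γ)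
    (show (0 : ℝ) ≤ 1 from zero_le_one) (show (0 : ℝ) ≤ 2 + 2 * κ / √γ by positivity)
    (sub_nonneg.2 hr1) hr0.le (by ring)
  simp only [smul_eq_mul, one_pow, mul_one] at h3
  have h4 : (1 + b) = 1 - r + r * (2 + 2 * κ / √γ) := by rw [hb]; ring
  rw [h4]
  linarith

end ConvexCaps

theorem mainTheorem2 (d : ℕ) (hd : 1 ≤ d) (γ : ℝ) (hγ0 : 0 < γ) (hγ1 : γ ≤ 1) :
    ∃ Δ₀ : ℝ, 0 < Δ₀ ∧
      ∀ a₁ a₂ b₁ b₂ : ℝ, 0 < a₁ → 0 < a₂ → 0 < b₁ → 0 < b₂ →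
        ∃ c : ℝ, 0 < c ∧
          ∀ (K : ConvexBody (EuclideanSpace ℝ (Fin d))), ConvexCaps.IsCanonical γ K →
            ∀ ε v : ℝ, 0 < ε → 0 < v →
              ∀ 𝒞 : Set (ConvexCaps.Cap K),
                (∀ C ∈ 𝒞, C.width ≤ Δ₀) →
                (∀ C ∈ 𝒞, a₁ * ε ≤ C.width ∧ C.width ≤ a₂ * ε) →
                (∀ C ∈ 𝒞, b₁ * v ≤ C.vol ∧ C.vol ≤ b₂ * v) →
                𝒞.PairwiseDisjoint (fun C => ConvexCaps.shrunkenMacbeath K C.baseCentroid) →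
                𝒞.Finite ∧ (𝒞.ncard : ℝ) ≤ c * min (ε / v) (v / ε ^ d) := by
  have hsγ : 0 < √γ := Real.sqrt_pos.2 hγ0
  have hsγ1 : √γ ≤ 1 := Real.sqrt_le_one.2 hγ1
  refine ⟨√γ / 2, by positivity, fun a₁ a₂ b₁ b₂ ha₁ ha₂ hb₁ hb₂ => ?_⟩
  have hd0 : 0 < d := hd
  set V := volume.real (Metric.closedBall (0 : EuclideanSpace ℝ (Fin d)) (1 / √γ)) with hV
  set m := volume.real (Metric.closedBall (0 : EuclideanSpace ℝ (Fin d)) (1 / d)) with hm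
  have hV0 : 0 ≤ V := measureReal_nonneg
  have hm0 : 0 < m := by
    refine ENNReal.toReal_pos (Metric.measure_closedBall_pos volume _ (by positivity)).ne' ?_
    exact (isCompact_closedBall _ _).measure_lt_top.ne
  set κ := a₂ / a₁ with hκ
  have hκ0 : 0 < κ := div_pos ha₂ ha₁
  set L : ℝ := (5 * 2 ^ (d + 4)) ^ d with hL
  have hL0 : 0 < L := by positivity
  set B : ℝ := (2 ^ (d + 5) * (1 + 2 * (4 + 2 * κ / √γ) / √γ)) ^ d with hB
  have hB0 : 0 < B := by positivity
  set E : ℝ := (2 + 2 * κ / √γ) ^ d + d with hE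
  have hE0 : 0 < E := by positivity
  -- The constants of the primal and of the dual count.
  set c₁ : ℝ := d * (2 * a₂ / √γ) * V * L / b₁ with hc₁
  set c₂ : ℝ := (B * (2 * b₂) * L / b₁) * (E * V) * (2 * b₂) /
    ((√γ / 2 ^ (d + 6)) ^ d * (m ^ 2 * ((1 / 2) ^ (d + 3) * √γ)) * a₁ ^ d) with hc₂
  have hc₁0 : 0 ≤ c₁ := by positivity
  have hc₂0 : 0 ≤ c₂ := by positivity
  refine ⟨c₁ + c₂ + 1, by positivity, fun K hK ε v hε hv 𝒞 hΔ hwidth hvol hdisj => ?_⟩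
  refine ConvexCaps.finite_and_ncard_le_of_forall_card_le fun F hF => ?_
  have hmin : 0 ≤ min (ε / v) (v / ε ^ d) := le_min (by positivity) (by positivity)
  rcases F.eq_empty_or_nonempty with rfl | ⟨C₀, hC₀⟩
  · simp only [Finset.card_empty, Nat.cast_zero]
    positivity
  have hr0 : 0 < a₁ * ε := mul_pos ha₁ hε
  have hshallow : ∀ C ∈ F, C.IsShallow γ := fun C hC =>
    ⟨hγ0, hK, hr0.trans_le (hwidth C (hF hC)).1, hΔ C (hF hC)⟩
  have hr1 : a₁ * ε ≤ 1 := by linarith [(hwidth C₀ (hF hC₀)).1, hΔ C₀ (hF hC₀)]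
  have hκr : κ * (a₁ * ε) = a₂ * ε := by rw [hκ]; field_simp
  have hvv : b₁ * v ≤ b₂ * v := (hvol C₀ (hF hC₀)).1.trans (hvol C₀ (hF hC₀)).2
  have h1 := ConvexCaps.card_mul_le_primal hγ0 hK (W := a₂ * ε) (A := b₁ * v) (by positivity) F
    hshallow (fun C hC => (hwidth C (hF hC)).2) (fun C hC => (hvol C (hF hC)).1) (hdisj.subset hF)
  have h2 := ConvexCaps.card_mul_le_dual hd0 hγ0 hK (κ := κ) (A := b₁ * v) (A' := b₂ * v) hr0 hr1
    hκ0 (by positivity) hvv F hshallow (fun C hC => (hwidth C (hF hC)).1)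
    (fun C hC => hκr ▸ (hwidth C (hF hC)).2) (fun C hC => (hvol C (hF hC)).1)
    (fun C hC => (hvol C (hF hC)).2) (hdisj.subset hF)
  rw [← hV, ← hL] at h1
  rw [← hm, ← hV, ← hB, ← hE, ← hL] at h2
  have h3 : (F.card : ℝ) ≤ c₁ * (ε / v) := by
    rw [← le_div_iff₀ (by positivity)] at h1
    refine h1.trans (le_of_eq ?_)
    rw [hc₁]
    field_simp
  have h4 : (F.card : ℝ) ≤ c₂ * (v / ε ^ d) := by
    rw [← le_div_iff₀ (by positivity)] at h2
    refine h2.trans (le_of_eq ?_)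
    rw [hc₂, mul_pow, mul_pow a₁]
    field_simp
  rcases min_choice (ε / v) (v / ε ^ d) with hmc | hmc
  all_goals
    rw [hmc] at hmin ⊢
    nlinarith [mul_nonneg hc₁0 hmin, mul_nonneg hc₂0 hmin]
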